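/- Let $\Omega$ be a non-void open subset of $\mathbb C^n$, $n\geqslant 1$, and let $m\geqslant 2$ be an integer. A function $u:\Omega\to[-\infty,\infty)$ is plurisubharmonic if it is upper semicontinuous and, for all $a,b\in\mathbb C^n$, the function $z\mapsto u(a+bz)$ is subharmonic or identically $-\infty$ on every connected component of $\{z\in\mathbb C: a+bz\in\Omega\}$. The pluri-fine topology $\tau$ on $\Omega$ is the coarsest topology on $\Omega$ for which all plurisubharmonic functions on $\Omega$ are continuous; $\tau_m$ denotes the pluri-fine topology on $\Omega^m$, regarded as an open subset of $\mathbb C^{mn}$. For a topological space $X$, a function $X\to\mathbb R$ is of Baire class $0$ if it is continuous and, for an integer $k\geqslant 1$, of Baire class $k$ if it is the pointwise limit of a sequence of functions each of which is of some Baire class less than $k$. Then for every function $g:\Omega\to\mathbb R$ of Baire class $m-1$ on $(\Omega,\tau)$ there is a function $f:\Omega^m\to\mathbb R$ such that $$g(x)=f(x,\dots,x)\qquad\text{for all } x\in\Omega,$$ and $f$ is separately continuous with respect to $\tau_m$, that is, for every $(x_1,\dots,x_m)\in\Omega^m$ and every $j\in\{1,\dots,m\}$ the restriction of $f$ to the set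 $\{(x_1,\dots,x_{j-1},x,x_{j+1},\dots,x_m): x\in\Omega\}$ is continuous in the subspace topology induced by $\tau_m$. -/

import Mathlib

open Filter Topology MeasureTheory

noncomputable section

/-- The mean value of `u` over the circle of centre `c` and radius `r`, as an extended real: the
integral of the positive part minus that of the negative part, divided by `2π`. If `u < ⊤` is upper
semicontinuous on the circle, then the first integral is finite, so `⊤ - ⊤` does not occur. -/
def circleMean (u : ℂ → EReal) (c : ℂ) (r : ℝ) : EReal :=
  (((∫⁻ θ in Set.Ioc 0 (2 * Real.pi), (u (circleMap c r θ)).toENNReal : ENNReal) : EReal) -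
    ((∫⁻ θ in Set.Ioc 0 (2 * Real.pi), (-u (circleMap c r θ)).toENNReal : ENNReal) : EReal)) /
    ((2 * Real.pi : ℝ) : EReal)

/-- `u` is subharmonic on the (open, connected) set `U ⊆ ℂ`: it takes values in `[-∞, ∞)`, is upper
semicontinuous, is not identically `-∞`, and satisfies the sub-mean value inequality on every
closed disc contained in `U`. -/
structure IsSubharmonicOn (u : ℂ → EReal) (U : Set ℂ) : Prop where
  lt_top : ∀ z ∈ U, u z < ⊤
  usc : UpperSemicontinuousOn u U
  exists_ne_bot : ∃ z ∈ U, u z ≠ ⊥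
  le_circleMean : ∀ (c : ℂ) (r : ℝ), 0 < r → Metric.closedBall c r ⊆ U → u c ≤ circleMean u c r

/-- `f` is plurisubharmonic on the open set `Ω` of `ℂ^ι` (only the values of `f` on `Ω` matter):
`f : Ω → [-∞, ∞)` is upper semicontinuous and, for all `a`, `b`, the function `z ↦ f (a + b z)` is
subharmonic or identically `-∞` on every component of `{z | a + b z ∈ Ω}`. -/
structure IsPshOn {ι : Type*} (f : (ι → ℂ) → EReal) (Ω : Set (ι → ℂ)) : Prop where
  lt_top : ∀ x ∈ Ω, f x < ⊤
  usc : UpperSemicontinuousOn f Ω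
  subharmonic_or_bot : ∀ (a b : ι → ℂ), ∀ z₀ ∈ {z : ℂ | a + z • b ∈ Ω},
    IsSubharmonicOn (fun z => f (a + z • b)) (connectedComponentIn {z : ℂ | a + z • b ∈ Ω} z₀) ∨
      ∀ z ∈ connectedComponentIn {z : ℂ | a + z • b ∈ Ω} z₀, f (a + z • b) = ⊥

/-- The pluri-fine topology on `Ω`: the coarsest topology for which all plurisubharmonic functions
on `Ω` are continuous. -/
def pluriFine {ι : Type*} (Ω : Set (ι → ℂ)) : TopologicalSpace Ω :=
  ⨅ (f : (ι → ℂ) → EReal) (_ : IsPshOn f Ω),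
    TopologicalSpace.induced (fun x : Ω => f x) inferInstance

/-- The subset of `ℂ^{mn}` corresponding to `Ω^m`, for `Ω ⊆ ℂ^n`. -/
def powSet {n : ℕ} (Ω : Set (Fin n → ℂ)) (m : ℕ) : Set (Fin m × Fin n → ℂ) :=
  {z | ∀ j, (fun k => z (j, k)) ∈ Ω}

/-- The identification of `Ω^m` with a subset of `ℂ^{mn}`. -/
def powEquiv {n : ℕ} (Ω : Set (Fin n → ℂ)) (m : ℕ) : (Fin m → Ω) ≃ powSet Ω m where
  toFun x := ⟨fun p => (x p.1 : Fin n → ℂ) p.2, fun j => (x j).2⟩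
  invFun z := fun j => ⟨fun k => (z : Fin m × Fin n → ℂ) (j, k), z.2 j⟩
  left_inv _ := rfl
  right_inv _ := rfl

/-- The pluri-fine topology on `Ω^m`, regarded as a subset of `ℂ^{mn}`. -/
def pluriFinePow {n : ℕ} (Ω : Set (Fin n → ℂ)) (m : ℕ) : TopologicalSpace (Fin m → Ω) :=
  TopologicalSpace.induced (powEquiv Ω m) (pluriFine (powSet Ω m))

/-- Functions of Baire class `m` for the topology `t`: class `0` consists of the continuous
functions and, for `m ≥ 1`, class `m` consists of the pointwise limits of sequences of functions
each of which is in a Baire class less than `m`. -/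
inductive IsBaireClass {X Y : Type*} (t : TopologicalSpace X) [TopologicalSpace Y] :
    ℕ → (X → Y) → Prop
  | of_continuous (f : X → Y) (hf : Continuous[t, inferInstance] f) : IsBaireClass t 0 f
  | of_tendsto (m : ℕ) (f : X → Y) (F : ℕ → X → Y) (c : ℕ → ℕ) (hc : ∀ k, c k < m)
      (hF : ∀ k, IsBaireClass t (c k) (F k))
      (hlim : ∀ x, Tendsto (fun k => F k x) atTop (𝓝 (f x))) : IsBaireClass t m f

/-- Separate continuity for a topology `μ` on a product: for each point `x` and each index `i`, the
restriction of `f` to the set of points that differ from `x` at most in coordinate `i` is continuous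
in the subspace topology generated by `μ`. -/
def SeparatelyContinuous {ι : Type*} [DecidableEq ι] {X : ι → Type*} {Y : Type*}
    [TopologicalSpace Y] (μ : TopologicalSpace (∀ i, X i)) (f : (∀ i, X i) → Y) : Prop :=
  ∀ (x : ∀ i, X i) (i : ι),
    @ContinuousOn _ _ μ _ f (Set.range fun t : X i => Function.update x i t)

/-- The diagonal mapping `d_m : X → X^m`. -/
def diagonalMap {X : Type*} (m : ℕ) (x : X) : Fin m → X := fun _ => x

end

/-! ### Interpolation of sequences at real points -/

section Interpolation

/-! A Baire function is built from countably many continuous functions `u i`, so it factors through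
the map `Φ = (u i)` onto a subspace of `ℕ → ℝ`, without loss of class
(`IsBaireClass.exists_countable_family`). On that metrizable space the classical diagonal theorem
holds (`IsBaireClass.exists_continuousInEach`). The resulting function is pulled back by `Φ` in each
variable. All this needs of `τ_m` is that the projections to `(Ω, τ)` are continuous.

The metric theorem goes by induction on the class; a limit is encoded by interpolating a sequence at
a parameter that tends to infinity at the diagonal. For class 1, `u (Nat.log 2 n) (p 0)` is
interpolated at `1 / √s`, with `s` a distance that dominates the differences of all `u i`. The slow
index keeps the values steady while `p 0` moves. For higher classes, the functions `F n` of one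
variable fewer are evaluated with one point removed, and the results are averaged over the removed
point. When a single point leaves the diagonal, all the weight falls on its removal, and what
remains is the sequence `F n (x, ..., x)`, which tends to `g x`. -/

/-- Piecewise linear interpolation, at the real point `t ≥ 0`, of the sequence `a`. -/
noncomputable def linearInterp (t : ℝ) (a : ℕ → ℝ) : ℝ :=
  (1 - (t - ⌊t⌋₊)) * a ⌊t⌋₊ + (t - ⌊t⌋₊) * a (⌊t⌋₊ + 1)

/-- The sum of tent functions has a range that is locally independent of `t`, so continuity is
visible even where `⌊t⌋₊` jumps. -/
theorem linearInterp_eq_sum {t : ℝ} (ht : 0 ≤ t) {N : ℕ} (hN : t + 1 ≤ N) (a : ℕ → ℝ) :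
    linearInterp t a = ∑ n ∈ Finset.range N, max 0 (1 - |t - n|) * a n := by
  have h1 := Nat.floor_le ht
  have h2 := Nat.lt_floor_add_one t
  have hle : ⌊t⌋₊ + 1 ≤ N := by
    have : ((⌊t⌋₊ + 1 : ℕ) : ℝ) ≤ N := by push_cast; linarith
    exact_mod_cast this
  have hsub : Finset.range (⌊t⌋₊ + 2) ⊆ Finset.range (N + 1) := by
    intro n hn
    simp only [Finset.mem_range] at *
    omega
  -- The node `⌊t⌋₊ + 1` may equal `N`; its tent then vanishes at `t`.
  have hN0 : max 0 (1 - |t - N|) * a N = 0 := by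
    have h3 : (1 : ℝ) ≤ |t - N| := by
      rw [abs_sub_comm]; exact le_trans (by linarith) (le_abs_self _)
    rw [max_eq_left (by linarith), zero_mul]
  have hsum := Finset.sum_range_succ (fun n : ℕ => max 0 (1 - |t - n|) * a n) N
  rw [hN0, add_zero] at hsum
  rw [← hsum, ← Finset.sum_subset hsub, Finset.sum_range_succ, Finset.sum_range_succ,
    Finset.sum_eq_zero, linearInterp]
  · rw [abs_of_nonneg (by linarith), max_eq_right (by linarith), abs_of_nonpos (by push_cast; linarith),
      max_eq_right (by push_cast; linarith)]
    push_cast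
    ring
  · intro n hn
    have hn' : ((n + 1 : ℕ) : ℝ) ≤ (⌊t⌋₊ : ℝ) := by exact_mod_cast Finset.mem_range.1 hn
    push_cast at hn'
    rw [abs_of_nonneg (by linarith), max_eq_left (by linarith), zero_mul]
  · intro n _ hn
    have hn' : ((⌊t⌋₊ + 2 : ℕ) : ℝ) ≤ (n : ℝ) := by
      exact_mod_cast not_lt.1 (fun h => hn (Finset.mem_range.2 h))
    push_cast at hn'
    rw [abs_of_nonpos (by linarith), max_eq_left (by linarith), zero_mul]

theorem ContinuousAt.linearInterp {Z : Type*} [TopologicalSpace Z] {z₀ : Z} {t : Z → ℝ}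
    {a : ℕ → Z → ℝ} (ht0 : ∀ z, 0 ≤ t z) (ht : ContinuousAt t z₀)
    (ha : ∀ n, ContinuousAt (a n) z₀) :
    ContinuousAt (fun z => linearInterp (t z) (fun n => a n z)) z₀ := by
  obtain ⟨N, hN⟩ := exists_nat_gt (t z₀ + 1)
  have hev : ∀ᶠ z in 𝓝 z₀, t z < N - 1 := ht.eventually (gt_mem_nhds (by linarith))
  have hsum : ContinuousAt
      (fun z => ∑ n ∈ Finset.range N, max 0 (1 - |t z - n|) * a n z) z₀ := by
    refine tendsto_finsetSum _ fun n _ => ?_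
    exact (continuousAt_const.max (continuousAt_const.sub (ht.sub continuousAt_const).abs)).mul
      (ha n)
  refine hsum.congr ?_
  filter_upwards [hev] with z hz
  exact (linearInterp_eq_sum (ht0 z) (by linarith) _).symm

theorem abs_linearInterp_sub_le {t : ℝ} (ht : 0 ≤ t) {a : ℕ → ℝ} {b ε : ℝ}
    (h : ∀ n : ℕ, |t - n| ≤ 1 → |a n - b| ≤ ε) : |linearInterp t a - b| ≤ ε := by
  have h1 := Nat.floor_le ht
  have h2 := Nat.lt_floor_add_one t
  have h3 := abs_le.1 (h ⌊t⌋₊ (abs_le.2 ⟨by linarith, by linarith⟩))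
  have h4 := abs_le.1 (h (⌊t⌋₊ + 1) (abs_le.2 ⟨by push_cast; linarith, by push_cast; linarith⟩))
  have e : linearInterp t a - b = (1 - (t - ⌊t⌋₊)) * (a ⌊t⌋₊ - b) +
      (t - ⌊t⌋₊) * (a (⌊t⌋₊ + 1) - b) := by
    rw [linearInterp]; ring
  rw [e, abs_le]
  have h5 : 0 ≤ t - ⌊t⌋₊ := by linarith
  have h6 : 0 ≤ 1 - (t - ⌊t⌋₊) := by linarith
  constructor
  · have := mul_le_mul_of_nonneg_left h3.1 h6
    have := mul_le_mul_of_nonneg_left h4.1 h5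
    linarith
  · have := mul_le_mul_of_nonneg_left h3.2 h6
    have := mul_le_mul_of_nonneg_left h4.2 h5
    linarith

/-- If `t → ∞` then the interpolation at `t` of a convergent sequence tends to its limit. -/
theorem tendsto_linearInterp {Z : Type*} {l : Filter Z} {t : Z → ℝ} {a : ℕ → ℝ} {b : ℝ}
    (ht : Tendsto t l atTop) (ha : Tendsto a atTop (𝓝 b)) :
    Tendsto (fun z => linearInterp (t z) a) l (𝓝 b) := by
  rw [Metric.tendsto_nhds]
  intro ε hε
  obtain ⟨M, hM⟩ := Metric.tendsto_atTop.1 ha (ε / 2) (by linarith)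
  filter_upwards [ht.eventually_ge_atTop ((M : ℝ) + 1)] with z hz
  have hM0 : (0 : ℝ) ≤ M := Nat.cast_nonneg M
  rw [Real.dist_eq]
  refine lt_of_le_of_lt (abs_linearInterp_sub_le (by linarith) (fun n hn => ?_)) (half_lt_self hε)
  have h1 := (abs_le.1 hn).2
  have h2 : (M : ℝ) ≤ n := by linarith
  have h3 := hM n (by exact_mod_cast h2)
  rw [Real.dist_eq] at h3
  exact h3.le

end Interpolation

/-! ### Baire functions and countable families of continuous functions -/

section BaireClass

variable {X Y : Type*}

theorem IsBaireClass.mono {t : TopologicalSpace X} [TopologicalSpace Y] {c k : ℕ} {g : X → Y}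
    (hg : IsBaireClass t c g) (h : c ≤ k) : IsBaireClass t k g := by
  rcases h.eq_or_lt with rfl | h
  · exact hg
  · exact .of_tendsto k g (fun _ => g) (fun _ => c) (fun _ => h) (fun _ => hg)
      (fun _ => tendsto_const_nhds)

theorem IsBaireClass.continuous {t : TopologicalSpace X} [TopologicalSpace Y] {g : X → Y}
    (hg : IsBaireClass t 0 g) : Continuous g := by
  cases hg with
  | of_continuous _ hf => exact hf
  | of_tendsto _ _ F c hc => exact absurd (hc 0) (Nat.not_lt_zero _)

theorem IsBaireClass.exists_tendsto {t : TopologicalSpace X} [TopologicalSpace Y] {k : ℕ}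
    {g : X → Y} (hg : IsBaireClass t (k + 1) g) : ∃ F : ℕ → X → Y,
      (∀ n, IsBaireClass t k (F n)) ∧ ∀ x, Tendsto (fun n => F n x) atTop (𝓝 (g x)) := by
  cases hg with
  | of_tendsto _ _ F c hc hF hlim =>
    exact ⟨F, fun n => (hF n).mono (Nat.lt_succ_iff.1 (hc n)), hlim⟩

/-- A Baire function depends on countably many continuous functions: it factors, as a function of
the same class, through every surjection through which these functions factor. -/
theorem IsBaireClass.exists_countable_family {t : TopologicalSpace X} {k : ℕ} {g : X → ℝ}
    (hg : IsBaireClass t k g) : ∃ u : ℕ → X → ℝ, (∀ i, Continuous (u i)) ∧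
      ∀ (Z : Type) (tZ : TopologicalSpace Z) (Φ : X → Z), Function.Surjective Φ →
        (∀ i, ∃ v : Z → ℝ, Continuous v ∧ u i = v ∘ Φ) →
        ∃ h : Z → ℝ, IsBaireClass tZ k h ∧ g = h ∘ Φ := by
  induction hg with
  | of_continuous f hf =>
    refine ⟨fun _ => f, fun _ => hf, fun Z tZ Φ _ hv => ?_⟩
    obtain ⟨v, hv, e⟩ := hv 0
    exact ⟨v, .of_continuous v hv, e⟩
  | of_tendsto m f F c hc hF hlim ih =>
    choose u hu hfac using ih
    refine ⟨fun i => u i.unpair.1 i.unpair.2, fun i => hu _ _, fun Z tZ Φ hΦ hv => ?_⟩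
    have hstep : ∀ n, ∃ h : Z → ℝ, IsBaireClass tZ (c n) h ∧ F n = h ∘ Φ := fun n =>
      hfac n Z tZ Φ hΦ fun i => by simpa using hv (Nat.pair n i)
    choose H hH hFH using hstep
    have hlim' : ∀ z, Tendsto (fun n => H n z) atTop (𝓝 (f (Function.surjInv hΦ z))) := by
      intro z
      have := hlim (Function.surjInv hΦ z)
      simpa only [hFH, Function.comp_apply, Function.surjInv_eq] using this
    refine ⟨fun z => f (Function.surjInv hΦ z), .of_tendsto m _ H c hc hH hlim', ?_⟩
    -- `Φ x` may have been assigned another preimage than `x`, but the same sequence converges to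
    -- both values.
    funext x
    refine tendsto_nhds_unique (hlim x) ?_
    simpa only [hFH, Function.comp_apply] using hlim' (Φ x)

end BaireClass

/-! ### Separate continuity and extension to the diagonal -/

section Diagonal

variable {Y : Type*}

/-- Continuity in each variable for the given topology of the factor. -/
def ContinuousInEach [TopologicalSpace Y] {m : ℕ} (f : (Fin m → Y) → ℝ) : Prop :=
  ∀ (p : Fin m → Y) (i : Fin m), ContinuousAt (fun y => f (Function.update p i y)) (p i)

theorem ContinuousInEach.continuous_update [TopologicalSpace Y] {m : ℕ} {f : (Fin m → Y) → ℝ}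
    (hf : ContinuousInEach f) (p : Fin m → Y) (i : Fin m) :
    Continuous (fun y => f (Function.update p i y)) := by
  refine continuous_iff_continuousAt.2 fun y => ?_
  simpa using hf (Function.update p i y) i

/-- Either the moving point is the removed one and nothing varies, or it is one of the variables of
`f`. -/
theorem ContinuousInEach.continuousAt_succAbove [TopologicalSpace Y] {m : ℕ}
    {f : (Fin m → Y) → ℝ} (hf : ContinuousInEach f) (p : Fin (m + 1) → Y) (i j : Fin (m + 1)) :
    ContinuousAt (fun y => f (fun a => Function.update p i y (j.succAbove a))) (p i) := by
  rcases eq_or_ne i j with rfl | hij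
  · simpa using continuousAt_const
  · obtain ⟨a, rfl⟩ := Fin.exists_succAbove_eq hij
    have e : ∀ y, (fun b => Function.update p (j.succAbove a) y (j.succAbove b)) =
        Function.update (fun b => p (j.succAbove b)) a y := fun y =>
      Function.update_comp_eq_of_injective p Fin.succAbove_right_injective a y
    simp only [e]
    exact hf _ a

/-- A function that is continuous in each variable off the diagonal and has limits along the
coordinate directions at the diagonal extends to the diagonal. -/
theorem exists_continuousInEach_of_tendsto [TopologicalSpace Y] [T2Space Y] {m : ℕ} (g : Y → ℝ)
    (G : (Fin (m + 2) → Y) → ℝ)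
    (hoff : ∀ p : Fin (m + 2) → Y, (∃ a b, p a ≠ p b) → ∀ i,
      ContinuousAt (fun y => G (Function.update p i y)) (p i))
    (hdiag : ∀ x i, Tendsto (fun y => G (Function.update (fun _ => x) i y)) (𝓝[≠] x) (𝓝 (g x))) :
    ∃ f : (Fin (m + 2) → Y) → ℝ, ContinuousInEach f ∧ ∀ x, f (fun _ => x) = g x := by
  classical
  refine ⟨fun p => if ∃ a b, p a ≠ p b then G p else g (p 0), fun p i => ?_, fun x => by simp⟩
  by_cases hp : ∃ a b, p a ≠ p b
  · refine (hoff p hp i).congr ?_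
    obtain ⟨a, b, hab⟩ := hp
    have hc : ∀ c, ContinuousAt (fun y => Function.update p i y c) (p i) := fun c =>
      ((continuous_apply c).comp
        (continuous_const.update (f := fun _ => p) i continuous_id)).continuousAt
    have hne : ∀ᶠ y in 𝓝 (p i), Function.update p i y a ≠ Function.update p i y b :=
      (hc a).ne_iff_eventually_ne (hc b) |>.1 (by simpa using hab)
    filter_upwards [hne] with y hy
    rw [if_pos ⟨a, b, hy⟩]
  · push Not at hp
    obtain ⟨x, rfl⟩ : ∃ x, p = fun _ => x := ⟨p 0, funext fun a => hp a 0⟩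
    rw [continuousAt_iff_punctured_nhds]
    simp only [Function.update_eq_self, ne_eq, not_true_eq_false, exists_const, if_false]
    refine (hdiag x i).congr' ?_
    filter_upwards [self_mem_nhdsWithin] with y hy
    -- With at least two variables, moving one of them away from `x` leaves the diagonal.
    obtain ⟨j, hj⟩ := exists_ne i
    exact (if_pos ⟨i, j, by simpa [Function.update_of_ne hj] using hy⟩).symm

theorem continuousAt_apply_update [TopologicalSpace Y] {Z : Type*} [TopologicalSpace Z] {m : ℕ}
    {F : (Fin m → Y) → Z} (p : Fin m → Y) (i : Fin m) (hF : ContinuousAt F p) :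
    ContinuousAt (fun y => F (Function.update p i y)) (p i) := by
  have h : ContinuousAt (fun y => Function.update p i y) (p i) :=
    (continuous_const.update i continuous_id).continuousAt
  exact ContinuousAt.comp (g := F) (by simpa using hF) h

end Diagonal

/-! ### Functions of the first Baire class on a metric space -/

section FirstClass

variable {Y : Type*}

/-- A distance that controls all the functions `u i` and, if these are continuous, is continuous. -/
noncomputable def controlDist [MetricSpace Y] (u : ℕ → Y → ℝ) (x y : Y) : ℝ :=
  dist x y + ∑' i, (1 / 2 : ℝ) ^ i * min 1 |u i x - u i y|

theorem summable_controlDist (u : ℕ → Y → ℝ) (x y : Y) :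
    Summable fun i => (1 / 2 : ℝ) ^ i * min 1 |u i x - u i y| := by
  refine Summable.of_nonneg_of_le (fun i => by positivity) (fun i => ?_) summable_geometric_two
  exact mul_le_of_le_one_right (by positivity) (min_le_left _ _)

variable [MetricSpace Y]

theorem dist_le_controlDist (u : ℕ → Y → ℝ) (x y : Y) : dist x y ≤ controlDist u x y :=
  le_add_of_nonneg_right (tsum_nonneg fun i => by positivity)

theorem controlDist_self (u : ℕ → Y → ℝ) (x : Y) : controlDist u x x = 0 := by
  simp [controlDist]

theorem controlDist_pos (u : ℕ → Y → ℝ) {x y : Y} (h : x ≠ y) : 0 < controlDist u x y :=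
  (dist_pos.2 h).trans_le (dist_le_controlDist u x y)

theorem min_abs_sub_le_controlDist (u : ℕ → Y → ℝ) (x y : Y) (i : ℕ) :
    min 1 |u i x - u i y| ≤ 2 ^ i * controlDist u x y := by
  have h := (summable_controlDist u x y).le_tsum i (fun j _ => by positivity)
  have h1 : (1 / 2 : ℝ) ^ i * min 1 |u i x - u i y| ≤ controlDist u x y :=
    h.trans (le_add_of_nonneg_left dist_nonneg)
  calc min 1 |u i x - u i y| = 2 ^ i * ((1 / 2 : ℝ) ^ i * min 1 |u i x - u i y|) := by
        rw [← mul_assoc, ← mul_pow]; norm_num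
    _ ≤ _ := mul_le_mul_of_nonneg_left h1 (by positivity)

theorem continuous_controlDist {u : ℕ → Y → ℝ} (hu : ∀ i, Continuous (u i)) :
    Continuous fun q : Y × Y => controlDist u q.1 q.2 := by
  refine continuous_dist.add (continuous_tsum (fun i => ?_) summable_geometric_two fun i q => ?_)
  · have := hu i
    fun_prop
  · rw [Real.norm_of_nonneg (by positivity)]
    exact mul_le_of_le_one_right (by positivity) (min_le_left _ _)

/-- At the resolution `1 / √s`, where `s` is the control distance, the functions that take part in
the interpolation hardly differ. -/
theorem abs_sub_lt_of_controlDist (u : ℕ → Y → ℝ) {x y : Y} {ε : ℝ} (hε : ε ≤ 1)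
    (hs : √(controlDist u x y) + 2 * controlDist u x y < ε) {n : ℕ}
    (hn : |1 / √(controlDist u x y) - n| ≤ 1) :
    |u (Nat.log 2 n) x - u (Nat.log 2 n) y| < ε := by
  set s := controlDist u x y with hsdef
  have hs0 : 0 ≤ s := dist_nonneg.trans (dist_le_controlDist u x y)
  -- The summand `1` is needed only for `n = 0`, where `Nat.log 2 0 = 0`.
  have hpow : (2 : ℝ) ^ Nat.log 2 n ≤ n + 1 := by
    rcases eq_or_ne n 0 with rfl | h0
    · simp
    · have : ((2 ^ Nat.log 2 n : ℕ) : ℝ) ≤ n := by exact_mod_cast Nat.pow_log_le_self 2 h0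
      push_cast at this
      linarith
  have hn1 : (n : ℝ) + 1 ≤ 1 / √s + 2 := by linarith [(abs_le.1 hn).1]
  have h1 : min 1 |u (Nat.log 2 n) x - u (Nat.log 2 n) y| ≤ √s + 2 * s :=
    calc _ ≤ 2 ^ Nat.log 2 n * s := min_abs_sub_le_controlDist u x y _
      _ ≤ (1 / √s + 2) * s := mul_le_mul_of_nonneg_right (hpow.trans hn1) hs0
      -- This also holds for `s = 0`, where `1 / √s` is `0`.
      _ = √s + 2 * s := by rw [add_mul, one_div_mul_eq_div, Real.div_sqrt]
  rcases min_lt_iff.1 (h1.trans_lt hs) with h | h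
  · linarith
  · exact h

theorem tendsto_one_div_atTop_of_continuous {Z : Type*} [TopologicalSpace Z] {s : Z → ℝ} {x : Z}
    (hs : Continuous s) (hx : s x = 0) (hpos : ∀ y, y ≠ x → 0 < s y) :
    Tendsto (fun y => 1 / s y) (𝓝[≠] x) atTop := by
  simp only [one_div]
  refine Tendsto.inv_tendsto_nhdsGT_zero (tendsto_nhdsWithin_iff.2 ⟨?_, ?_⟩)
  · have := hs.tendsto x
    rw [hx] at this
    exact this.mono_left nhdsWithin_le_nhds
  · filter_upwards [self_mem_nhdsWithin] with y hy using hpos y hy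

theorem tendsto_sqrt_controlDist {u : ℕ → Y → ℝ} (hu : ∀ i, Continuous (u i)) (x : Y) :
    Tendsto (fun y => 1 / √(controlDist u y x)) (𝓝[≠] x) atTop ∧
      Tendsto (fun y => 1 / √(controlDist u x y)) (𝓝[≠] x) atTop := by
  have hc := continuous_controlDist hu
  constructor
  · refine tendsto_one_div_atTop_of_continuous (s := fun y => √(controlDist u y x))
      (Real.continuous_sqrt.comp (hc.comp (continuous_id.prodMk continuous_const))) ?_
      fun y hy => Real.sqrt_pos.2 (controlDist_pos u hy)
    simp [controlDist_self]
  · refine tendsto_one_div_atTop_of_continuous (s := fun y => √(controlDist u x y))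
      (Real.continuous_sqrt.comp (hc.comp (continuous_const.prodMk continuous_id))) ?_
      fun y hy => Real.sqrt_pos.2 (controlDist_pos u hy.symm)
    simp [controlDist_self]

/-- The functions are evaluated at the moving point `y`, where convergence need not be uniform. The
nodes in use are so low compared with `controlDist u y x` that the values at `y` can be replaced by
those at `x`. -/
theorem tendsto_linearInterp_controlDist {u : ℕ → Y → ℝ} {b : ℝ} {x : Y}
    (hu : ∀ i, Continuous (u i)) (hlim : Tendsto (fun n => u (Nat.log 2 n) x) atTop (𝓝 b)) :
    Tendsto (fun y => linearInterp (1 / √(controlDist u y x)) (fun n => u (Nat.log 2 n) y))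
      (𝓝[≠] x) (𝓝 b) := by
  rw [Metric.tendsto_nhds]
  intro ε hε
  obtain ⟨M, hM⟩ := Metric.tendsto_atTop.1 hlim (ε / 4) (by linarith)
  have hc : Continuous fun y => √(controlDist u y x) + 2 * controlDist u y x := by
    have : Continuous fun y => controlDist u y x :=
      (continuous_controlDist hu).comp (continuous_id.prodMk continuous_const)
    fun_prop
  have hsmall : ∀ᶠ y in 𝓝[≠] x,
      √(controlDist u y x) + 2 * controlDist u y x < min 1 (ε / 4) := by
    refine nhdsWithin_le_nhds (hc.continuousAt.eventually (gt_mem_nhds ?_))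
    simpa [controlDist_self] using hε
  filter_upwards [hsmall, (tendsto_sqrt_controlDist hu x).1.eventually_ge_atTop ((M : ℝ) + 1)]
    with y hy hz
  rw [Real.dist_eq]
  refine lt_of_le_of_lt (abs_linearInterp_sub_le (by positivity) (fun n hn => ?_))
    (half_lt_self hε)
  have h1 := (abs_le.1 hn).2
  have h2 : (M : ℝ) ≤ n := by linarith
  have h3 := hM n (by exact_mod_cast h2)
  rw [Real.dist_eq] at h3
  have h4 := abs_sub_lt_of_controlDist u (min_le_left _ _) hy hn
  have h5 := abs_sub_le (u (Nat.log 2 n) y) (u (Nat.log 2 n) x) b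
  linarith [min_le_right (1 : ℝ) (ε / 4)]

/-- Every function of the first Baire class on a metric space is the diagonal of a separately
continuous function of two variables. -/
theorem exists_continuousInEach_of_tendsto_continuous {u : ℕ → Y → ℝ} {g : Y → ℝ}
    (hu : ∀ i, Continuous (u i)) (hlim : ∀ x, Tendsto (fun n => u n x) atTop (𝓝 (g x))) :
    ∃ f : (Fin 2 → Y) → ℝ, ContinuousInEach f ∧ ∀ x, f (fun _ => x) = g x := by
  -- Repeating each `u i` for `2 ^ i ≤ n < 2 ^ (i + 1)` does not change the limit.
  have hlog : ∀ x, Tendsto (fun n : ℕ => u (Nat.log 2 n) x) atTop (𝓝 (g x)) := fun x =>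
    (hlim x).comp (tendsto_atTop_atTop.2 fun b =>
      ⟨2 ^ b, fun n hn => Nat.le_log_of_pow_le one_lt_two hn⟩)
  refine exists_continuousInEach_of_tendsto (m := 0) g
    (fun p => linearInterp (1 / √(controlDist u (p 0) (p 1))) (fun n => u (Nat.log 2 n) (p 0)))
    (fun p hp i => ?_) (fun x i => ?_)
  · have hne : p 0 ≠ p 1 := by
      intro h
      obtain ⟨a, b, hab⟩ := hp
      fin_cases a <;> fin_cases b <;> simp_all
    refine continuousAt_apply_update (F := fun p : Fin 2 → Y =>
      linearInterp (1 / √(controlDist u (p 0) (p 1))) (fun n => u (Nat.log 2 n) (p 0))) p i ?_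
    refine ContinuousAt.linearInterp (a := fun n (p : Fin 2 → Y) => u (Nat.log 2 n) (p 0))
      (fun _ => by positivity) ?_
      fun n => ((hu _).comp (continuous_apply 0)).continuousAt
    refine continuousAt_const.div (Continuous.continuousAt ?_)
      (Real.sqrt_pos.2 (controlDist_pos u hne)).ne'
    have hpair : Continuous fun p : Fin 2 → Y => (p 0, p 1) := by fun_prop
    exact Real.continuous_sqrt.comp ((continuous_controlDist hu).comp hpair)
  · fin_cases i
    · simpa using tendsto_linearInterp_controlDist hu (hlog x)
    · simpa using tendsto_linearInterp (tendsto_sqrt_controlDist hu x).2 (hlog x)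

end FirstClass

/-! ### Higher Baire classes: one more variable for each limit -/

section HigherClass

variable {Y : Type*} [MetricSpace Y]

/-- The sum of the mutual distances of the points `p a`. -/
def spread {m : ℕ} (p : Fin m → Y) : ℝ := ∑ a, ∑ b, dist (p a) (p b)

theorem spread_nonneg {m : ℕ} (p : Fin m → Y) : 0 ≤ spread p :=
  Finset.sum_nonneg fun _ _ => Finset.sum_nonneg fun _ _ => dist_nonneg

theorem continuous_spread {m : ℕ} : Continuous (spread : (Fin m → Y) → ℝ) := by
  unfold spread
  fun_prop

theorem spread_const {m : ℕ} (x : Y) : spread (fun _ : Fin m => x) = 0 := by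
  simp [spread]

theorem spread_pos {m : ℕ} {p : Fin m → Y} {a b : Fin m} (h : p a ≠ p b) : 0 < spread p :=
  calc 0 < dist (p a) (p b) := dist_pos.2 h
    _ ≤ ∑ b, dist (p a) (p b) :=
      Finset.single_le_sum (f := fun b => dist (p a) (p b)) (fun _ _ => dist_nonneg)
        (Finset.mem_univ b)
    _ ≤ spread p :=
      Finset.single_le_sum (f := fun a => ∑ b, dist (p a) (p b))
        (fun _ _ => Finset.sum_nonneg fun _ _ => dist_nonneg) (Finset.mem_univ a)

theorem eq_of_spread_eq_zero {m : ℕ} {p : Fin m → Y} (h : spread p = 0) (a b : Fin m) :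
    p a = p b := by
  by_contra hab
  exact (spread_pos hab).ne' h

/-- The product of the spreads of the configurations obtained by removing one point other than
`p i`. It vanishes when all points but some `p j`, `j ≠ i`, coincide. -/
def removalProd {m : ℕ} (p : Fin (m + 1) → Y) (i : Fin (m + 1)) : ℝ :=
  ∏ j ∈ Finset.univ.erase i, spread fun a => p (j.succAbove a)

theorem removalProd_nonneg {m : ℕ} (p : Fin (m + 1) → Y) (i : Fin (m + 1)) :
    0 ≤ removalProd p i :=
  Finset.prod_nonneg fun _ _ => spread_nonneg _

theorem continuous_removalProd {m : ℕ} (i : Fin (m + 1)) :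
    Continuous fun p : Fin (m + 1) → Y => removalProd p i :=
  continuous_finsetProd _ fun j _ => continuous_spread.comp (by fun_prop)

theorem removalProd_eq_zero {m : ℕ} {p : Fin (m + 1) → Y} {i j : Fin (m + 1)} (hij : j ≠ i)
    (h : spread (fun a => p (j.succAbove a)) = 0) : removalProd p i = 0 :=
  Finset.prod_eq_zero (Finset.mem_erase.2 ⟨hij, Finset.mem_univ j⟩) h

/-- If at least three points do not all coincide, then removing a point makes the others coincide
for one choice of that point at most. -/
theorem eq_of_spread_removal_eq_zero {m : ℕ} {p : Fin (m + 3) → Y} {i j : Fin (m + 3)}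
    (hp : ∃ a b, p a ≠ p b) (hi : spread (fun a => p (i.succAbove a)) = 0)
    (hj : spread (fun a => p (j.succAbove a)) = 0) : i = j := by
  by_contra hij
  have key : ∀ l : Fin (m + 3), spread (fun a => p (l.succAbove a)) = 0 →
      ∀ a b, a ≠ l → b ≠ l → p a = p b := by
    intro l hl a b ha hb
    obtain ⟨a, rfl⟩ := Fin.exists_succAbove_eq ha
    obtain ⟨b, rfl⟩ := Fin.exists_succAbove_eq hb
    exact eq_of_spread_eq_zero hl a b
  -- A third index links the two removals: every point equals `p c`.
  obtain ⟨c, hc⟩ : ∃ c : Fin (m + 3), c ∉ ({i, j} : Finset (Fin (m + 3))) := by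
    by_contra! h
    have h1 : (Finset.univ : Finset (Fin (m + 3))).card ≤ ({i, j} : Finset (Fin (m + 3))).card :=
      Finset.card_le_card fun x _ => h x
    have h2 := Finset.card_le_two (a := i) (b := j)
    rw [Finset.card_univ, Fintype.card_fin] at h1
    omega
  simp only [Finset.mem_insert, Finset.mem_singleton, not_or] at hc
  have all : ∀ a, p a = p c := by
    intro a
    by_cases ha : a = i
    · exact key j hj a c (ha ▸ hij) hc.2
    · exact key i hi a c ha hc.1
  obtain ⟨a, b, hab⟩ := hp
  exact hab ((all a).trans (all b).symm)

/-- If removing point `i` makes the others coincide, no other removal does, and `removalProd p i`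
omits the vanishing factor. Two points would not do: single points have spread `0`. -/
theorem sum_removalProd_pos {m : ℕ} {p : Fin (m + 3) → Y} (hp : ∃ a b, p a ≠ p b) :
    0 < ∑ i, removalProd p i := by
  suffices h : ∃ i, removalProd p i ≠ 0 by
    obtain ⟨i, hi⟩ := h
    exact Finset.sum_pos' (fun _ _ => removalProd_nonneg _ _)
      ⟨i, Finset.mem_univ i, (removalProd_nonneg p i).lt_of_ne' hi⟩
  by_cases h : ∃ i : Fin (m + 3), spread (fun a => p (i.succAbove a)) = 0
  · obtain ⟨i, hi⟩ := h
    refine ⟨i, Finset.prod_ne_zero_iff.2 fun j hj h0 => ?_⟩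
    exact (Finset.mem_erase.1 hj).1 (eq_of_spread_removal_eq_zero hp h0 hi)
  · push Not at h
    exact ⟨0, Finset.prod_ne_zero_iff.2 fun j _ => h j⟩

/-- Passing to a pointwise limit at the cost of one more variable: a limit of diagonals of
separately continuous functions of `m + 2` variables is the diagonal of a separately continuous
function of `m + 3` variables. -/
theorem exists_continuousInEach_of_tendsto_diagonal {m : ℕ} {F : ℕ → (Fin (m + 2) → Y) → ℝ}
    {g : Y → ℝ} (hF : ∀ n, ContinuousInEach (F n))
    (hlim : ∀ x, Tendsto (fun n => F n fun _ => x) atTop (𝓝 (g x))) :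
    ∃ f : (Fin (m + 3) → Y) → ℝ, ContinuousInEach f ∧ ∀ x, f (fun _ => x) = g x := by
  refine exists_continuousInEach_of_tendsto (m := m + 1) g
    (fun p => ∑ i, removalProd p i / (∑ l, removalProd p l) *
      linearInterp (1 / spread p) (fun n => F n fun a => p (i.succAbove a)))
    (fun p hp i => ?_) (fun x i => ?_)
  · refine tendsto_finsetSum _ fun j _ => ContinuousAt.mul ?_ ?_
    · refine continuousAt_apply_update
        (F := fun p : Fin (m + 3) → Y => removalProd p j / ∑ l, removalProd p l) p i ?_
      exact (continuous_removalProd j).continuousAt.div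
        (continuous_finsetSum _ fun l _ => continuous_removalProd l).continuousAt
        (sum_removalProd_pos hp).ne'
    · refine ContinuousAt.linearInterp
        (a := fun n y => F n fun a => Function.update p i y (j.succAbove a))
        (fun _ => div_nonneg zero_le_one (spread_nonneg _)) ?_
        fun n => (hF n).continuousAt_succAbove p i j
      refine continuousAt_apply_update (F := fun p : Fin (m + 3) → Y => 1 / spread p) p i ?_
      obtain ⟨a, b, hab⟩ := hp
      exact continuousAt_const.div continuous_spread.continuousAt (spread_pos hab).ne'
  · obtain ⟨j, hj⟩ := exists_ne i
    have hne : ∀ y, y ≠ x → Function.update (fun _ => x) i y i ≠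
        Function.update (fun _ : Fin (m + 3) => x) i y j := fun y hy => by
      simpa [Function.update_of_ne hj] using hy
    have hT : Tendsto (fun y => 1 / spread (Function.update (fun _ : Fin (m + 3) => x) i y))
        (𝓝[≠] x) atTop :=
      tendsto_one_div_atTop_of_continuous
        (s := fun y => spread (Function.update (fun _ : Fin (m + 3) => x) i y))
        (continuous_spread.comp
          (continuous_const.update (f := fun _ _ => x) i continuous_id))
        (by rw [Function.update_eq_self]; exact spread_const x)
        (fun y hy => spread_pos (hne y hy))
    refine (tendsto_linearInterp hT (hlim x)).congr' ?_
    filter_upwards [self_mem_nhdsWithin] with y hy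
    have hrem : (fun a => Function.update (fun _ : Fin (m + 3) => x) i y (i.succAbove a)) =
        fun _ => x := by
      funext a
      simp
    -- For `l ≠ i` the product contains the factor for the removal of `i`, the spread of a constant
    -- configuration.
    have hz : ∀ l, l ≠ i → removalProd (Function.update (fun _ : Fin (m + 3) => x) i y) l = 0 :=
      fun l hl => removalProd_eq_zero hl.symm (by rw [hrem]; exact spread_const x)
    have hpos := sum_removalProd_pos ⟨i, j, hne y hy⟩
    have hsum := Finset.sum_eq_single_of_mem
      (f := removalProd (Function.update (fun _ : Fin (m + 3) => x) i y)) i (Finset.mem_univ i)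
      fun l _ hl => hz l hl
    rw [Finset.sum_eq_single_of_mem i (Finset.mem_univ i) fun l _ hl => by
      rw [hz l hl, zero_div, zero_mul]]
    rw [hrem, hsum, div_self (hsum ▸ hpos.ne'), one_mul]

/-- Every function of Baire class `k` on a metrizable space is the diagonal of a separately
continuous function of `k + 1` variables. -/
theorem IsBaireClass.exists_continuousInEach {Y : Type*} [t : TopologicalSpace Y]
    [TopologicalSpace.MetrizableSpace Y] (k : ℕ) {g : Y → ℝ} (hg : IsBaireClass t k g) :
    ∃ f : (Fin (k + 1) → Y) → ℝ, ContinuousInEach f ∧ ∀ x, f (fun _ => x) = g x := by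
  let _ := TopologicalSpace.metrizableSpaceMetric Y
  induction k generalizing g with
  | zero =>
    refine ⟨fun p => g (p 0), fun p i => ?_, fun _ => rfl⟩
    exact continuousAt_apply_update (F := fun p : Fin 1 → Y => g (p 0)) p i
      (hg.continuous.comp (continuous_apply 0)).continuousAt
  | succ k ih =>
    obtain ⟨u, hu, hlim⟩ := hg.exists_tendsto
    -- Class 1 is separate because the averaging needs at least three points.
    cases k with
    | zero => exact exists_continuousInEach_of_tendsto_continuous (fun i => (hu i).continuous) hlim
    | succ k =>
      choose F hF hFu using fun n => ih (hu n)
      exact exists_continuousInEach_of_tendsto_diagonal hF (by simpa only [hFu] using hlim)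

end HigherClass

/-! ### Projections in the pluri-fine topology -/

section PluriFine

theorem IsSubharmonicOn.mono {u : ℂ → EReal} {U V : Set ℂ} (hu : IsSubharmonicOn u U)
    (hVU : V ⊆ U) (hne : ∃ z ∈ V, u z ≠ ⊥) : IsSubharmonicOn u V where
  lt_top z hz := hu.lt_top z (hVU hz)
  usc := hu.usc.mono hVU
  exists_ne_bot := hne
  le_circleMean c r hr h := hu.le_circleMean c r hr (h.trans hVU)

/-- A plurisubharmonic function of one of the variables is plurisubharmonic on the power. -/
theorem IsPshOn.comp_proj {n : ℕ} {Ω : Set (Fin n → ℂ)} {f : (Fin n → ℂ) → EReal}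
    (hf : IsPshOn f Ω) (m : ℕ) (j : Fin m) :
    IsPshOn (fun z : Fin m × Fin n → ℂ => f fun k => z (j, k)) (powSet Ω m) where
  lt_top z hz := hf.lt_top _ (hz j)
  usc := hf.usc.comp (Continuous.continuousOn (by fun_prop)) fun z hz => hz j
  subharmonic_or_bot a b z₀ hz₀ := by
    -- The other coordinates also restrict `z`, so the components can shrink, possibly to sets where
    -- the function is `⊥` throughout.
    have hsub : {z : ℂ | a + z • b ∈ powSet Ω m} ⊆
        {z : ℂ | (fun k => a (j, k)) + z • (fun k => b (j, k)) ∈ Ω} := fun z hz => hz j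
    have hcomp := connectedComponentIn_mono z₀ hsub
    by_cases hbot : ∀ z ∈ connectedComponentIn {z : ℂ | a + z • b ∈ powSet Ω m} z₀,
        f (fun k => (a + z • b) (j, k)) = ⊥
    · exact Or.inr hbot
    · push Not at hbot
      rcases hf.subharmonic_or_bot (fun k => a (j, k)) (fun k => b (j, k)) z₀ (hsub hz₀)
        with h | h
      · exact Or.inl (h.mono hcomp hbot)
      · obtain ⟨z, hz, hne⟩ := hbot
        exact absurd (h z (hcomp hz)) hne

theorem continuous_pluriFinePow_apply {n : ℕ} (Ω : Set (Fin n → ℂ)) (m : ℕ) (j : Fin m) :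
    @Continuous _ _ (pluriFinePow Ω m) (pluriFine Ω) (fun x => x j) := by
  let _ := pluriFinePow Ω m
  refine continuous_iInf_rng.2 fun f => continuous_iInf_rng.2 fun hf => continuous_induced_rng.2 ?_
  have h : @Continuous _ _ (pluriFine (powSet Ω m)) _
      (fun z : powSet Ω m => f fun k => (z : Fin m × Fin n → ℂ) (j, k)) :=
    continuous_iff_le_induced.2 (iInf₂_le (fun z : Fin m × Fin n → ℂ => f fun k => z (j, k))
      (hf.comp_proj m j))
  exact @Continuous.comp _ _ _ (pluriFinePow Ω m) (pluriFine (powSet Ω m)) _ _ _ h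
    continuous_induced_dom

end PluriFine

/-! ### Transfer from the metrizable quotient -/

/-- On every topological space, a Baire function of class `k` is the diagonal of a function of
`k + 1` variables that is separately continuous for every topology on the power that makes the
projections continuous. -/
theorem IsBaireClass.exists_separatelyContinuous {X : Type*} {t : TopologicalSpace X} {k : ℕ}
    {g : X → ℝ} (hg : IsBaireClass t k g) (μ : TopologicalSpace (Fin (k + 1) → X))
    (hμ : ∀ j, @Continuous _ _ μ t fun x => x j) :
    ∃ f : (Fin (k + 1) → X) → ℝ, SeparatelyContinuous μ f ∧ g = f ∘ diagonalMap (k + 1) := by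
  obtain ⟨u, hu, hfac⟩ := hg.exists_countable_family
  -- The range, unlike all of `ℕ → ℝ`, makes `Φ` surjective; it is still metrizable.
  let Φ : X → Set.range (fun x i => u i x : X → ℕ → ℝ) := Set.rangeFactorization _
  have hΦ : Continuous Φ := (continuous_pi hu).subtype_mk _
  obtain ⟨h, hh, rfl⟩ := hfac _ inferInstance Φ Set.rangeFactorization_surjective fun i =>
    ⟨fun z => (z : ℕ → ℝ) i, (continuous_apply i).comp continuous_subtype_val, rfl⟩
  obtain ⟨f, hf, hfh⟩ := hh.exists_continuousInEach
  refine ⟨fun x => f fun j => Φ (x j), fun x i => ?_, funext fun x => (hfh (Φ x)).symm⟩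
  -- With the other coordinates frozen, this function depends on `p i` alone, so it is continuous
  -- for `μ` and agrees with the candidate on the slice.
  have hcont : Continuous fun p : Fin (k + 1) → X =>
      f (Function.update (fun j => Φ (x j)) i (Φ (p i))) :=
    (hf.continuous_update _ i).comp (hΦ.comp (hμ i))
  refine hcont.continuousOn.congr ?_
  rintro _ ⟨y, rfl⟩
  refine congrArg f (funext fun j => ?_)
  rcases eq_or_ne j i with rfl | hj
  · simp
  · simp [Function.update_of_ne hj]

theorem theorem2p1 (n : ℕ) (hn : 1 ≤ n) (Ω : Set (Fin n → ℂ)) (hΩ : IsOpen Ω)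
    (hne : Ω.Nonempty) (m : ℕ) (hm : 2 ≤ m) (g : Ω → ℝ)
    (hg : IsBaireClass (pluriFine Ω) (m - 1) g) :
    ∃ f : (Fin m → Ω) → ℝ,
      SeparatelyContinuous (pluriFinePow Ω m) f ∧ g = f ∘ diagonalMap m := by
  obtain ⟨k, rfl⟩ : ∃ k, m = k + 1 := ⟨m - 1, by omega⟩
  exact hg.exists_separatelyContinuous (pluriFinePow Ω (k + 1))
    fun j => continuous_pluriFinePow_apply Ω (k + 1) j
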